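/- Fix $p\in[1,\infty]$. For a probability space $(\Omega,\mathcal A,P)$, a random variable in $L^p(\Omega,P)$ is a measurable function $X:\Omega\to\mathbb R$ with finite $L^p$-norm. A coherent risk measure on $L^p(\Omega,P)$ is a map $\rho$ from these random variables to $\mathbb R\cup\{+\infty\}$ such that, for all $X,Y\in L^p(\Omega,P)$ (with $0\cdot(+\infty)=0$): - $\rho(X)\le\rho(Y)$ whenever $X\le Y$ almost surely; - $\rho(\lambda X)=\lambda\rho(X)$ for all real $\lambda>0$; - $\rho((1-\lambda)X+\lambda Y)\le(1-\lambda)\rho(X)+\lambda\rho(Y)$ for all $\lambda\in[0,1]$; - $\rho(X+c)=\rho(X)+c$ for all $c\in\mathbb R$. It is law invariant if $\rho(X)=\rho(Y)$ whenever $X$ and $Y$ have the same distribution. Let $(\Omega,2^\Omega,P)$ be a uniform discrete probability space, i.e. $\Omega$ is a finite set with $n\ge 1$ elements and $P(\{\omega\})=1/n$ for every $\omega\in\Omega$ (so that $L^p(\Omega,P)$ consists of all functions $\Omega\to\mathbb R$). Then every law invariant coherent risk measure $\rho$ on $L^p(\Omega,P)$ is functionally coherent: there is a law invariant coherent risk measure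 $\varrho$ on $L^p([0,1])$, where $[0,1]$ carries the Borel $\sigma$-algebra and Lebesgue measure, whose restriction is $\rho$, in the sense that $\rho(X)=\varrho(Y)$ whenever $X:\Omega\to\mathbb R$ and $Y\in L^p([0,1])$ have the same distribution. -/

import Mathlib

open MeasureTheory ProbabilityTheory
open scoped ENNReal

/-- The real vector space of `p`-integrable random variables on a probability space: genuine
(everywhere defined, measurable) functions `Ω → ℝ` with finite `L^p` seminorm. -/
def RandomVariables {Ω : Type*} [MeasurableSpace Ω] (p : ℝ≥0∞) (P : Measure Ω) :
    Submodule ℝ (Ω → ℝ) where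
  carrier := {X | Measurable X ∧ MemLp X p P}
  add_mem' hX hY := ⟨hX.1.add hY.1, hX.2.add hY.2⟩
  zero_mem' := ⟨measurable_zero, MemLp.zero⟩
  smul_mem' c _ hX := ⟨hX.1.const_smul c, hX.2.const_smul c⟩

/-- The constant random variable `c`. -/
def constRV {Ω : Type*} [MeasurableSpace Ω] (p : ℝ≥0∞) (P : Measure Ω) [IsProbabilityMeasure P]
    (c : ℝ) : RandomVariables p P :=
  ⟨fun _ => c, measurable_const, memLp_const c⟩

/-- On a finite space with the power set as sigma-algebra, every function is a random variable. -/
theorem mem_randomVariables_of_finite {Ω : Type*} [Finite Ω] [MeasurableSpace Ω]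
    [DiscreteMeasurableSpace Ω] (p : ℝ≥0∞) (P : Measure Ω) [IsProbabilityMeasure P]
    (X : Ω → ℝ) : X ∈ RandomVariables p P :=
  ⟨Measurable.of_discrete, MemLp.of_discrete⟩

/-- A coherent risk measure on `L^p(Ω, P)`, with values in `ℝ ∪ {+∞}` (that is, in the extended
reals without `-∞`). -/
structure IsCoherentRiskMeasure {Ω : Type*} [MeasurableSpace Ω] (p : ℝ≥0∞) (P : Measure Ω)
    [IsProbabilityMeasure P] (ρ : RandomVariables p P → EReal) : Prop where
  ne_bot : ∀ X, ρ X ≠ ⊥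
  monotone : ∀ X Y : RandomVariables p P, (∀ᵐ ω ∂P, X.1 ω ≤ Y.1 ω) → ρ X ≤ ρ Y
  pos_homogeneous : ∀ (X : RandomVariables p P) (t : ℝ), 0 < t → ρ (t • X) = (t : EReal) * ρ X
  convex : ∀ (X Y : RandomVariables p P) (t : ℝ), 0 ≤ t → t ≤ 1 →
    ρ ((1 - t) • X + t • Y) ≤ ((1 - t : ℝ) : EReal) * ρ X + (t : EReal) * ρ Y
  translation : ∀ (X : RandomVariables p P) (c : ℝ), ρ (X + constRV p P c) = ρ X + (c : EReal)

/-- Law invariance: random variables with the same distribution have the same risk. -/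
def IsLawInvariant {Ω : Type*} [MeasurableSpace Ω] (p : ℝ≥0∞) (P : Measure Ω)
    (ρ : RandomVariables p P → EReal) : Prop :=
  ∀ X Y : RandomVariables p P, IdentDistrib X.1 Y.1 P P → ρ X = ρ Y

/-- A law invariant mapping `ρ` on `L^p(Ω, P)` is functionally coherent if it is the restriction
of a law invariant coherent risk measure `ϱ` on `L^p` of the standard atomless space, the unit
interval with its Borel sigma-algebra and Lebesgue measure. A random variable `X` on `Ω` is
identified with the random variables `Y` on `[0,1]` that have its distribution. -/
def IsFunctionallyCoherent {Ω : Type*} [MeasurableSpace Ω] (p : ℝ≥0∞) (P : Measure Ω)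
    (ρ : RandomVariables p P → EReal) : Prop :=
  IsLawInvariant p P ρ ∧
  ∃ ϱ : RandomVariables p (volume : Measure unitInterval) → EReal,
    IsCoherentRiskMeasure p volume ϱ ∧ IsLawInvariant p volume ϱ ∧
    ∀ (X : RandomVariables p P) (Y : RandomVariables p (volume : Measure unitInterval)),
      IdentDistrib X.1 Y.1 P volume → ρ X = ϱ Y

/-! Let `ϱ Y` be the supremum of `ρ` over all vectors of averages of `Y` on fuzzy partitions of
`[0,1]` into `n` pieces of mass `1/n`. For a fixed partition, averaging is linear, monotone and
fixes constants, so coherence passes to the supremum. Conditioning the partition on `Y` leaves the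
averages unchanged and makes them depend only on the law of `Y` (`IsAllocation.exists_factor`);
hence the construction gives equal values to equally distributed variables, even on different
spaces. It remains to compute it on `Ω` itself. There a fuzzy partition is a doubly stochastic
matrix `D`; by Birkhoff's theorem `D X` is a convex combination of rearrangements of `X`, so `ρ (D
X) ≤ ρ X`, with equality for the identity matrix. -/

/-- A fuzzy partition of the space `S` into pieces of equal mass, indexed by `Ω`. -/
structure IsAllocation {Ω S : Type*} [Fintype Ω] [MeasurableSpace S] (μ : Measure S)
    (φ : Ω → S → ℝ) : Prop where
  aestronglyMeasurable : ∀ ω, AEStronglyMeasurable (φ ω) μ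
  nonneg : ∀ ω, 0 ≤ᵐ[μ] φ ω
  sum_eq_one : ∀ᵐ s ∂μ, ∑ ω, φ ω s = 1
  card_mul_integral : ∀ ω, (Fintype.card Ω : ℝ) * ∫ s, φ ω s ∂μ = 1

/-- The vector of averages of `Y` over the pieces of a fuzzy partition into equal masses. -/
noncomputable def allocationMean {Ω S : Type*} [Fintype Ω] [MeasurableSpace S] (μ : Measure S)
    (φ : Ω → S → ℝ) (Y : S → ℝ) : Ω → ℝ :=
  fun ω => (Fintype.card Ω : ℝ) * ∫ s, φ ω s * Y s ∂μ

/-- The largest risk of the averages of `Y` over fuzzy partitions into equal masses. -/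
noncomputable def allocationExtension {Ω S : Type*} [Fintype Ω] [MeasurableSpace Ω]
    [DiscreteMeasurableSpace Ω] {P : Measure Ω} [IsProbabilityMeasure P] {p : ℝ≥0∞}
    [MeasurableSpace S] (ρ : RandomVariables p P → EReal) (μ : Measure S)
    (Y : RandomVariables p μ) : EReal :=
  ⨆ φ : {φ : Ω → S → ℝ // IsAllocation μ φ},
    ρ ⟨allocationMean μ φ.1 Y.1, mem_randomVariables_of_finite p P _⟩

theorem RandomVariables.integrable {S : Type*} [MeasurableSpace S] {p : ℝ≥0∞} {μ : Measure S}
    [IsProbabilityMeasure μ] (hp : 1 ≤ p) (Y : RandomVariables p μ) : Integrable Y.1 μ :=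
  Y.2.2.integrable hp

/-! ### Fuzzy partitions and their averages. -/

namespace IsAllocation

variable {Ω S T : Type*} [Fintype Ω] [MeasurableSpace S] [MeasurableSpace T] {μ : Measure S}
  {ν : Measure T} {φ : Ω → S → ℝ}

theorem le_one (h : IsAllocation μ φ) (ω : Ω) : ∀ᵐ s ∂μ, φ ω s ≤ 1 := by
  filter_upwards [ae_all_iff.2 h.nonneg, h.sum_eq_one] with s h0 h1
  rw [← h1]
  exact Finset.single_le_sum (f := fun ω => φ ω s) (fun ω _ => h0 ω) (Finset.mem_univ ω)

theorem norm_le_one (h : IsAllocation μ φ) (ω : Ω) : ∀ᵐ s ∂μ, ‖φ ω s‖ ≤ 1 := by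
  filter_upwards [h.nonneg ω, h.le_one ω] with s h0 h1
  rwa [Real.norm_of_nonneg h0]

theorem integrable_mul (h : IsAllocation μ φ) (ω : Ω) {Y : S → ℝ} (hY : Integrable Y μ) :
    Integrable (fun s => φ ω s * Y s) μ :=
  hY.bdd_mul (h.aestronglyMeasurable ω) (h.norm_le_one ω)

theorem integrable [IsProbabilityMeasure μ] (h : IsAllocation μ φ) (ω : Ω) :
    Integrable (φ ω) μ := by
  simpa using h.integrable_mul ω (integrable_const (1 : ℝ))

/-- Makes the supremum defining the extension nonempty, so that it avoids `⊥`. -/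
theorem const [Nonempty Ω] [IsProbabilityMeasure μ] :
    IsAllocation μ (fun (_ : Ω) (_ : S) => (Fintype.card Ω : ℝ)⁻¹) where
  aestronglyMeasurable _ := aestronglyMeasurable_const
  nonneg _ := by filter_upwards with s using by simp
  sum_eq_one := by filter_upwards with s using by simp
  card_mul_integral _ := by simp

theorem mean_mono (h : IsAllocation μ φ) {X Y : S → ℝ} (hX : Integrable X μ)
    (hY : Integrable Y μ) (hXY : ∀ᵐ s ∂μ, X s ≤ Y s) (ω : Ω) :
    allocationMean μ φ X ω ≤ allocationMean μ φ Y ω := by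
  refine mul_le_mul_of_nonneg_left ?_ (Nat.cast_nonneg _)
  refine integral_mono_ae (h.integrable_mul ω hX) (h.integrable_mul ω hY) ?_
  filter_upwards [h.nonneg ω, hXY] with s h0 h1 using mul_le_mul_of_nonneg_left h1 h0

theorem mean_add (h : IsAllocation μ φ) {X Y : S → ℝ} (hX : Integrable X μ)
    (hY : Integrable Y μ) :
    allocationMean μ φ (X + Y) = allocationMean μ φ X + allocationMean μ φ Y := by
  funext ω
  simp only [allocationMean, Pi.add_apply, mul_add]
  rw [integral_add (h.integrable_mul ω hX) (h.integrable_mul ω hY), mul_add]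

theorem mean_const (h : IsAllocation μ φ) (c : ℝ) :
    allocationMean μ φ (fun _ => c) = fun _ => c := by
  funext ω
  simp only [allocationMean]
  rw [integral_mul_const, ← mul_assoc, h.card_mul_integral, one_mul]

/-- A fuzzy partition can be averaged over the level sets of `Y`. -/
theorem exists_factor [IsProbabilityMeasure μ] (h : IsAllocation μ φ) {Y : S → ℝ}
    (hm : Measurable Y) (hY : Integrable Y μ) :
    ∃ g : Ω → ℝ → ℝ, (∀ ω, Measurable (g ω)) ∧ IsAllocation μ (fun ω s => g ω (Y s)) ∧
      allocationMean μ (fun ω s => g ω (Y s)) Y = allocationMean μ φ Y := by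
  have hle := hm.comap_le
  -- Doob–Dynkin: the conditional expectation given `Y` is a function of `Y`.
  have key (ω : Ω) : ∃ g : ℝ → ℝ, StronglyMeasurable g ∧ μ[φ ω | MeasurableSpace.comap Y Real.measurableSpace] = g ∘ Y :=
    stronglyMeasurable_condExp.exists_eq_measurable_comp
  choose g hg hgY using key
  have hgs (ω : Ω) (s : S) : g ω (Y s) = (μ[φ ω | MeasurableSpace.comap Y Real.measurableSpace]) s := by rw [hgY]; rfl
  have hYm : StronglyMeasurable[MeasurableSpace.comap Y Real.measurableSpace] Y := (comap_measurable Y).stronglyMeasurable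
  refine ⟨g, fun ω => (hg ω).measurable, ⟨fun ω => ?_, fun ω => ?_, ?_, fun ω => ?_⟩, ?_⟩
  · exact ((hg ω).measurable.comp hm).aestronglyMeasurable
  · filter_upwards [condExp_nonneg (m := MeasurableSpace.comap Y Real.measurableSpace) (h.nonneg ω)] with s hs
    simpa only [hgs] using hs
  · have h1 : μ[∑ ω, φ ω |
        MeasurableSpace.comap Y Real.measurableSpace] =ᵐ[μ] μ[fun _ => (1 : ℝ) |
        MeasurableSpace.comap Y Real.measurableSpace] := by
      refine condExp_congr_ae ?_
      filter_upwards [h.sum_eq_one] with s hs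
      simpa using hs
    have h2 := condExp_finsetSum (s := Finset.univ) (fun ω _ => h.integrable ω)
      (MeasurableSpace.comap Y Real.measurableSpace)
    rw [condExp_const hle] at h1
    filter_upwards [h1, h2] with s hs1 hs2
    simp only [hgs]
    rw [← hs1, hs2, Finset.sum_apply]
  · simp only [hgs]
    rw [integral_condExp hle, h.card_mul_integral]
  · funext ω
    simp only [allocationMean, hgs]
    congr 1
    -- `Y` can be pulled out of the conditional expectation of `φ ω * Y` given `Y`.
    rw [← integral_condExp (f := fun s => φ ω s * Y s) hle]
    refine integral_congr_ae ?_
    filter_upwards [condExp_mul_of_stronglyMeasurable_right hYm (h.integrable_mul ω hY)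
      (h.integrable ω)] with s hs
    exact hs.symm

/-- Fuzzy partitions that are functions of a random variable only depend on its law. -/
theorem of_identDistrib {X : S → ℝ} {Y : T → ℝ} (hXY : IdentDistrib X Y μ ν) {g : Ω → ℝ → ℝ}
    (hg : ∀ ω, Measurable (g ω)) (h : IsAllocation μ (fun ω s => g ω (X s))) :
    IsAllocation ν (fun ω t => g ω (Y t)) where
  aestronglyMeasurable ω :=
    ((hg ω).comp_aemeasurable hXY.aemeasurable_snd).aestronglyMeasurable
  nonneg ω := hXY.ae_snd (p := fun x => 0 ≤ g ω x) (measurableSet_le measurable_const (hg ω))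
    (h.nonneg ω)
  sum_eq_one := hXY.ae_snd (p := fun x => ∑ ω, g ω x = 1)
    (measurableSet_eq_fun (Finset.measurable_sum _ fun ω _ => hg ω) measurable_const) h.sum_eq_one
  card_mul_integral ω := by
    rw [← h.card_mul_integral ω]
    exact congrArg _ (hXY.comp (hg ω)).integral_eq.symm

end IsAllocation

/-- Both sides integrate `x ↦ g ω x * x` against the common law. -/
theorem allocationMean_eq_of_identDistrib {Ω S T : Type*} [Fintype Ω] [MeasurableSpace S]
    [MeasurableSpace T] {μ : Measure S} {ν : Measure T} {X : S → ℝ} {Y : T → ℝ}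
    (hXY : IdentDistrib X Y μ ν) {g : Ω → ℝ → ℝ} (hg : ∀ ω, Measurable (g ω)) :
    allocationMean μ (fun ω s => g ω (X s)) X = allocationMean ν (fun ω t => g ω (Y t)) Y := by
  funext ω
  exact congrArg _ (hXY.comp ((hg ω).mul measurable_id)).integral_eq

theorem allocationMean_smul {Ω S : Type*} [Fintype Ω] [MeasurableSpace S] (μ : Measure S)
    (φ : Ω → S → ℝ) (c : ℝ) (Y : S → ℝ) :
    allocationMean μ φ (c • Y) = c • allocationMean μ φ Y := by
  funext ω
  simp only [allocationMean, Pi.smul_apply, smul_eq_mul, mul_left_comm _ c, integral_const_mul]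

/-! ### Convexity and uniform finite spaces. -/

/-- Sublevel sets of a coherent risk measure are convex. -/
theorem IsCoherentRiskMeasure.convex_sublevel {Ω : Type*} [MeasurableSpace Ω]
    {P : Measure Ω} [IsProbabilityMeasure P] {p : ℝ≥0∞} {ρ : RandomVariables p P → EReal}
    (hρ : IsCoherentRiskMeasure p P ρ) (r : EReal) :
    Convex ℝ {X | ρ X ≤ r} := by
  intro X hX Y hY a b ha hb hab
  obtain rfl : a = 1 - b := by linarith
  refine (hρ.convex X Y b hb (by linarith)).trans ?_
  have ha' := EReal.coe_nonneg.2 ha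
  have hb' := EReal.coe_nonneg.2 hb
  calc ((1 - b : ℝ) : EReal) * ρ X + (b : EReal) * ρ Y
      ≤ ((1 - b : ℝ) : EReal) * r + (b : EReal) * r :=
        add_le_add (mul_le_mul_of_nonneg_left hX ha') (mul_le_mul_of_nonneg_left hY hb')
    _ = r := by
        -- Nonnegative weights keep distributivity valid even for infinite `r`.
        rw [← EReal.right_distrib_of_nonneg ha' hb', ← EReal.coe_add, hab, EReal.coe_one, one_mul]

theorem measurePreserving_equiv_of_uniform {Ω : Type*} [Fintype Ω] [MeasurableSpace Ω]
    [DiscreteMeasurableSpace Ω] {P : Measure Ω}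
    (hP : ∀ ω : Ω, P {ω} = 1 / (Fintype.card Ω : ℝ≥0∞)) (σ : Equiv.Perm Ω) :
    MeasurePreserving σ P P := by
  refine ⟨Measurable.of_discrete, Measure.ext_of_singleton fun ω => ?_⟩
  rw [Measure.map_apply Measurable.of_discrete (measurableSet_singleton ω),
    ← σ.image_symm_eq_preimage, Set.image_singleton, hP, hP]

/-- Each point has positive mass, so only the empty set is null. -/
theorem ae_iff_forall_of_uniform {Ω : Type*} [Fintype Ω] [MeasurableSpace Ω] {P : Measure Ω}
    (hP : ∀ ω : Ω, P {ω} = 1 / (Fintype.card Ω : ℝ≥0∞))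
    {q : Ω → Prop} : (∀ᵐ ω ∂P, q ω) ↔ ∀ ω, q ω := by
  refine ⟨fun h ω => ?_, fun h => Filter.Eventually.of_forall h⟩
  by_contra hω
  have : P {ω} ≤ 0 := (measure_mono (by simpa using hω)).trans_eq (ae_iff.1 h)
  simp [hP] at this

/-! ### Law invariance and coherence of the extension. -/

section Extension

variable {Ω S T : Type*} [Fintype Ω] [MeasurableSpace Ω] [DiscreteMeasurableSpace Ω]
  {P : Measure Ω} [IsProbabilityMeasure P] {p : ℝ≥0∞} {ρ : RandomVariables p P → EReal}
  [MeasurableSpace S] [MeasurableSpace T] {μ : Measure S} {ν : Measure T}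

theorem le_allocationExtension {φ : Ω → S → ℝ} (h : IsAllocation μ φ) (Y : RandomVariables p μ) :
    ρ ⟨allocationMean μ φ Y.1, mem_randomVariables_of_finite p P _⟩ ≤
      allocationExtension ρ μ Y :=
  le_iSup (fun φ : {φ : Ω → S → ℝ // IsAllocation μ φ} =>
    ρ ⟨allocationMean μ φ.1 Y.1, mem_randomVariables_of_finite p P _⟩) ⟨φ, h⟩

theorem allocationExtension_le_of_identDistrib [IsProbabilityMeasure μ] (hp : 1 ≤ p)
    {X : RandomVariables p μ} {Y : RandomVariables p ν} (hXY : IdentDistrib X.1 Y.1 μ ν) :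
    allocationExtension ρ μ X ≤ allocationExtension ρ ν Y := by
  refine iSup_le fun ⟨φ, h⟩ => ?_
  obtain ⟨g, hg, hgX, hmean⟩ := h.exists_factor X.2.1 (RandomVariables.integrable hp X)
  simp only [← hmean, allocationMean_eq_of_identDistrib hXY hg]
  exact le_allocationExtension (hgX.of_identDistrib hXY hg) Y

theorem allocationExtension_eq_of_identDistrib [IsProbabilityMeasure μ] [IsProbabilityMeasure ν]
    (hp : 1 ≤ p) {X : RandomVariables p μ} {Y : RandomVariables p ν}
    (hXY : IdentDistrib X.1 Y.1 μ ν) :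
    allocationExtension ρ μ X = allocationExtension ρ ν Y :=
  le_antisymm (allocationExtension_le_of_identDistrib hp hXY)
    (allocationExtension_le_of_identDistrib hp hXY.symm)

/-- The extension by fuzzy partitions inherits coherence. -/
theorem IsCoherentRiskMeasure.allocationExtension [IsProbabilityMeasure μ] (hp : 1 ≤ p)
    (hρ : IsCoherentRiskMeasure p P ρ) :
    IsCoherentRiskMeasure p μ (allocationExtension ρ μ) := by
  have hΩ : Nonempty Ω := nonempty_of_isProbabilityMeasure P
  have hsmul (X : RandomVariables p μ) (t : ℝ) (ht : 0 < t) :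
      _root_.allocationExtension ρ μ (t • X) ≤ (t : EReal) * _root_.allocationExtension ρ μ X := by
    refine iSup_le fun ⟨φ, h⟩ => ?_
    refine le_trans (le_of_eq ?_) (mul_le_mul_of_nonneg_left (le_allocationExtension h X)
      (EReal.coe_nonneg.2 ht.le))
    rw [← hρ.pos_homogeneous _ t ht]
    exact congrArg ρ (Subtype.ext (allocationMean_smul μ φ t X.1))
  have hadd (X : RandomVariables p μ) (c : ℝ) :
      _root_.allocationExtension ρ μ (X + constRV p μ c) ≤
        _root_.allocationExtension ρ μ X + (c : EReal) := by
    refine iSup_le fun ⟨φ, h⟩ => ?_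
    refine le_trans (le_of_eq ?_) (add_le_add_left (le_allocationExtension h X) (c : EReal))
    rw [← hρ.translation _ c]
    refine congrArg ρ (Subtype.ext ?_)
    refine (h.mean_add (RandomVariables.integrable hp X) (integrable_const c)).trans ?_
    rw [h.mean_const]
    rfl
  constructor
  · intro X hX
    have := le_allocationExtension (ρ := ρ) (IsAllocation.const (Ω := Ω) (μ := μ)) X
    rw [hX, le_bot_iff] at this
    exact hρ.ne_bot _ this
  · intro X Y hXY
    refine iSup_le fun ⟨φ, h⟩ => ?_
    refine le_trans (hρ.monotone _ _ ?_) (le_allocationExtension h Y)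
    filter_upwards with ω using h.mean_mono (RandomVariables.integrable hp X) (RandomVariables.integrable hp Y) hXY ω
  · intro X t ht
    refine le_antisymm (hsmul X t ht) ?_
    -- The reverse inequality is `hsmul` for `t • X` and the factor `t⁻¹`.
    have h := mul_le_mul_of_nonneg_left (hsmul (t • X) t⁻¹ (inv_pos.2 ht))
      (EReal.coe_nonneg.2 ht.le)
    rwa [smul_smul, inv_mul_cancel₀ ht.ne', one_smul, ← mul_assoc, ← EReal.coe_mul,
      mul_inv_cancel₀ ht.ne', EReal.coe_one, one_mul] at h
  · intro X Y t h0 h1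
    refine iSup_le fun ⟨φ, h⟩ => ?_
    refine le_trans (le_trans (le_of_eq ?_) (hρ.convex
      ⟨allocationMean μ φ X.1, mem_randomVariables_of_finite p P _⟩
      ⟨allocationMean μ φ Y.1, mem_randomVariables_of_finite p P _⟩ t h0 h1)) ?_
    · refine congrArg ρ (Subtype.ext ?_)
      refine (h.mean_add ((RandomVariables.integrable hp X).smul (1 - t)) ((RandomVariables.integrable hp Y).smul t)).trans ?_
      exact congrArg₂ (· + ·) (allocationMean_smul μ φ (1 - t) X.1) (allocationMean_smul μ φ t Y.1)
    · exact add_le_add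
        (mul_le_mul_of_nonneg_left (le_allocationExtension h X)
          (EReal.coe_nonneg.2 (sub_nonneg.2 h1)))
        (mul_le_mul_of_nonneg_left (le_allocationExtension h Y) (EReal.coe_nonneg.2 h0))
  · intro X c
    refine le_antisymm (hadd X c) ?_
    have hX : X + constRV p μ c + constRV p μ (-c) = X :=
      Subtype.ext (funext fun s => add_neg_cancel_right (X.1 s) c)
    -- Likewise, shifting back by `-c` reverses `hadd`.
    have h := add_le_add_left (hadd (X + constRV p μ c) (-c)) (c : EReal)
    rwa [hX, add_assoc, ← EReal.coe_add, neg_add_cancel, EReal.coe_zero, add_zero] at h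

/-! ### Birkhoff's theorem and the extension on the uniform space. -/

/-- A law invariant coherent risk measure on a uniform space decreases under doubly stochastic
matrices. -/
theorem IsCoherentRiskMeasure.mulVec_le [DecidableEq Ω]
    (hP : ∀ ω : Ω, P {ω} = 1 / (Fintype.card Ω : ℝ≥0∞)) (hρ : IsCoherentRiskMeasure p P ρ)
    (hlaw : IsLawInvariant p P ρ) {D : Matrix Ω Ω ℝ} (hD : D ∈ doublyStochastic ℝ Ω)
    (X : RandomVariables p P) :
    ρ ⟨D.mulVec X.1, mem_randomVariables_of_finite p P _⟩ ≤ ρ X := by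
  obtain ⟨w, hw0, hw1, rfl⟩ := exists_eq_sum_perm_of_mem_doublyStochastic hD
  -- Each `X ∘ σ` has the law of `X`, hence lies in the sublevel set at `ρ X`.
  have hmem := (hρ.convex_sublevel (ρ X)).sum_mem (t := Finset.univ) (w := w)
    (z := fun σ => ⟨X.1 ∘ σ, mem_randomVariables_of_finite p P _⟩) (fun σ _ => hw0 σ) hw1
    fun σ _ => le_of_eq <| hlaw _ _
      ⟨Measurable.of_discrete.aemeasurable, X.2.1.aemeasurable, by
        rw [← Measure.map_map X.2.1 Measurable.of_discrete,
          (measurePreserving_equiv_of_uniform hP σ).map_eq]⟩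
  refine le_trans (le_of_eq (congrArg ρ (Subtype.ext ?_))) hmem
  rw [Matrix.sum_mulVec, AddSubmonoidClass.coe_finsetSum]
  refine Finset.sum_congr rfl fun σ _ => ?_
  rw [Matrix.smul_mulVec, Matrix.permMatrix_mulVec]
  rfl

theorem card_mul_integral_of_uniform (hP : ∀ ω : Ω, P {ω} = 1 / (Fintype.card Ω : ℝ≥0∞))
    (f : Ω → ℝ) : (Fintype.card Ω : ℝ) * ∫ ω, f ω ∂P = ∑ ω, f ω := by
  have hΩ : Nonempty Ω := nonempty_of_isProbabilityMeasure P
  rw [integral_fintype Integrable.of_finite, Finset.mul_sum]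
  refine Finset.sum_congr rfl fun ω _ => ?_
  simp [measureReal_def, hP]

/-- On the uniform space itself, the extension by fuzzy partitions changes nothing. -/
theorem IsCoherentRiskMeasure.allocationExtension_self
    (hP : ∀ ω : Ω, P {ω} = 1 / (Fintype.card Ω : ℝ≥0∞)) (hρ : IsCoherentRiskMeasure p P ρ)
    (hlaw : IsLawInvariant p P ρ) (X : RandomVariables p P) :
    _root_.allocationExtension ρ P X = ρ X := by
  classical
  refine le_antisymm (iSup_le fun ⟨φ, h⟩ => ?_) ?_
  -- Row sums are 1 by equal masses, column sums by the partition property.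
  · have hD : Matrix.of φ ∈ doublyStochastic ℝ Ω := by
      refine mem_doublyStochastic_iff_sum.2 ⟨fun i j => ?_, fun i => ?_, fun j => ?_⟩
      · exact (ae_iff_forall_of_uniform hP).1 (h.nonneg i) j
      · rw [← h.card_mul_integral i, card_mul_integral_of_uniform hP]
        rfl
      · exact (ae_iff_forall_of_uniform hP).1 h.sum_eq_one j
    refine le_trans (le_of_eq (congrArg ρ (Subtype.ext (funext fun ω => ?_))))
      (hρ.mulVec_le hP hlaw hD X)
    exact card_mul_integral_of_uniform hP _
  -- The identity matrix, whose averages are `X` itself.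
  · have h : IsAllocation P (fun ω ω' : Ω => if ω = ω' then (1 : ℝ) else 0) :=
      { aestronglyMeasurable := fun _ => Measurable.of_discrete.aestronglyMeasurable
        nonneg := fun ω => Filter.Eventually.of_forall fun ω' => by
          simp only [Pi.zero_apply]; positivity
        sum_eq_one := Filter.Eventually.of_forall fun ω' => by simp
        card_mul_integral := fun ω => by rw [card_mul_integral_of_uniform hP]; simp }
    refine le_trans (le_of_eq (congrArg ρ (Subtype.ext (funext fun ω => ?_))))
      (le_allocationExtension h X)
    simp [allocationMean, card_mul_integral_of_uniform hP]

end Extension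

theorem corollary3p6 {Ω : Type*} [Fintype Ω] [MeasurableSpace Ω] [DiscreteMeasurableSpace Ω]
    (P : Measure Ω) [IsProbabilityMeasure P]
    (hP : ∀ ω : Ω, P {ω} = 1 / (Fintype.card Ω : ℝ≥0∞))
    (p : ℝ≥0∞) (hp : 1 ≤ p) (ρ : RandomVariables p P → EReal)
    (hcoh : IsCoherentRiskMeasure p P ρ) (hlaw : IsLawInvariant p P ρ) :
    IsFunctionallyCoherent p P ρ := by
  refine ⟨hlaw, allocationExtension ρ volume, hcoh.allocationExtension hp,
    fun _ _ h => allocationExtension_eq_of_identDistrib hp h, fun X Y h => ?_⟩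
  rw [← hcoh.allocationExtension_self hP hlaw X]
  exact allocationExtension_eq_of_identDistrib hp h
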